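/- All Banach spaces are real. A Banach space $X$ has the Daugavet property if $\|\mathrm{Id}+T\|=1+\|T\|$ for every bounded operator $T\colon X\to X$ of rank one. If $X$ is a subspace of a Banach space $Y$ and $J\colon X\to Y$ is the inclusion, the pair $(X,Y)$ has the Daugavet property if $\|J+T\|=1+\|T\|$ for every bounded operator $T\colon X\to Y$ of rank one. For a topological space $K$, let $\ell_\infty(K)$ be the space of bounded functions $f\colon K\to\mathbb R$ with the supremum norm, let $m(K)$ be its closed subspace of those $f$ for which $\{t\in K: f(t)\neq 0\}$ is of first category in $K$, let $m_0(K)=\ell_\infty(K)/m(K)$ with the quotient norm, and let $Q\colon \ell_\infty(K)\to m_0(K)$ be the quotient map. **Theorem.** Let $Y$ be a separable real Banach space and let $X\subset Y$ be a closed subspace that has the Daugavet property (in its own norm). (a) Suppose $X\neq\{0\}$. Let $K=\overline{\operatorname{ext} B_{X^*}}^{\,w^*}$ be the weak$^*$ closure of the set of extreme points of the closed unit ball of $X^*$, with the weak$^*$ topology, and regard $x\in X$ as the element $x^*\mapsto x^*(x)$ of $\ell_\infty(K)$. Then there is an isomorphic embedding $S\colon Y\to m_0(K)$ (a bounded linear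 operator with $\|Sy\|\ge c\|y\|$ for all $y\in Y$ and some constant $c>0$) such that $Sx=Qx$ for all $x\in X$. (b) There is an equivalent norm on $Y$ that coincides with the original norm on $X$ and for which the pair $(X,Y)$ has the Daugavet property. -/

import Mathlib

open scoped ENNReal

noncomputable section

namespace Daugavet

universe u v

/-- The Daugavet equation `‖J + T‖ = 1 + ‖T‖` holds for every bounded operator `T` of rank one
(`J` is going to be the identity of a space or the inclusion of a subspace). -/
def DaugavetEquation {E : Type u} {F : Type v} [NormedAddCommGroup E] [NormedSpace ℝ E]
    [NormedAddCommGroup F] [NormedSpace ℝ F] (J : E →L[ℝ] F) : Prop :=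
  ∀ T : E →L[ℝ] F, (T : E →ₗ[ℝ] F).rank = 1 → ‖J + T‖ = 1 + ‖T‖

/-- The space `E` has the Daugavet property: `‖Id + T‖ = 1 + ‖T‖` for all rank-one `T : E → E`. -/
def IsDaugavetSpace (E : Type u) [NormedAddCommGroup E] [NormedSpace ℝ E] : Prop :=
  DaugavetEquation (ContinuousLinearMap.id ℝ E)

/-- The pair `(X, Y)`, with `X` a subspace of `Y`, has the Daugavet property:
`‖J + T‖ = 1 + ‖T‖` for all rank-one `T : X → Y`, where `J : X → Y` is the inclusion. -/
def IsDaugavetPair {Y : Type u} [NormedAddCommGroup Y] [NormedSpace ℝ Y]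
    (X : Submodule ℝ Y) : Prop :=
  DaugavetEquation X.subtypeL

/-! ### The space `m₀(K)` -/

/-- `ℓ_∞(K)`: the bounded real functions on `K`, with the supremum norm. -/
abbrev EllInfty (K : Type u) : Type u := lp (fun _ : K => ℝ) ∞

/-- `m(K)`: the bounded functions whose set of nonzeros is of first category (meagre) in `K`. -/
def mSpace (K : Type u) [TopologicalSpace K] : Submodule ℝ (EllInfty K) where
  carrier := {f | IsMeagre {t : K | f t ≠ 0}}
  zero_mem' := by
    have h : {t : K | (0 : EllInfty K) t ≠ 0} = ∅ := by ext t; simp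
    change IsMeagre {t : K | (0 : EllInfty K) t ≠ 0}
    rw [h]
    exact IsMeagre.empty
  add_mem' := by
    intro f g hf hg
    refine (hf.union hg).mono ?_
    intro t ht
    by_contra h
    simp only [Set.mem_union, Set.mem_ofPred_eq, not_or, not_not] at h
    exact ht (by simp [h.1, h.2])
  smul_mem' := by
    intro c f hf
    refine hf.mono ?_
    intro t ht h
    exact ht (by simp [h])

/-- `m(K)` is closed in `ℓ_∞(K)`, so that the quotient seminorm is a norm. -/
instance mSpace_isClosed (K : Type u) [TopologicalSpace K] :
    IsClosed (mSpace K : Set (EllInfty K)) := by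
  refine isClosed_of_closure_subset ?_
  intro f hf
  obtain ⟨g, hg, hlim⟩ := mem_closure_iff_seq_limit.1 hf
  have hU : IsMeagre (⋃ n, {t : K | g n t ≠ 0}) := isMeagre_iUnion fun n => hg n
  refine hU.mono ?_
  intro t ht
  by_contra h
  simp only [Set.mem_iUnion, Set.mem_ofPred_eq, not_exists, not_not] at h
  apply ht
  have hle : ∀ n, ‖f t‖ ≤ ‖g n - f‖ := by
    intro n
    have h1 := lp.norm_apply_le_norm (p := ∞) (by simp) (g n - f) t
    simpa [h n] using h1
  have hz : Filter.Tendsto (fun n => ‖g n - f‖) Filter.atTop (nhds 0) :=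
    tendsto_iff_norm_sub_tendsto_zero.1 hlim
  exact norm_le_zero_iff.1 (ge_of_tendsto' hz hle)

/-- `m₀(K) = ℓ_∞(K) / m(K)`, with the quotient norm. -/
abbrev mZero (K : Type u) [TopologicalSpace K] : Type u := EllInfty K ⧸ mSpace K

/-- The quotient map `Q : ℓ_∞(K) → m₀(K)`. -/
abbrev quotientMap (K : Type u) [TopologicalSpace K] : EllInfty K →ₗ[ℝ] mZero K :=
  (mSpace K).mkQ

/-! ### The weak* closure of the extreme points of the dual ball -/

/-- The closed unit ball `B_{E*}`, as a set in `E*` with the weak* topology. -/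
def dualBall (E : Type u) [NormedAddCommGroup E] [NormedSpace ℝ E] : Set (WeakDual ℝ E) :=
  WeakDual.toStrongDual ⁻¹' Metric.closedBall 0 1

/-- The weak* closure of the set of extreme points of `B_{E*}`. -/
def extClosure (E : Type u) [NormedAddCommGroup E] [NormedSpace ℝ E] : Set (WeakDual ℝ E) :=
  closure ((dualBall E).extremePoints ℝ)

theorem extClosure_subset (E : Type u) [NormedAddCommGroup E] [NormedSpace ℝ E] :
    extClosure E ⊆ dualBall E :=
  closure_minimal extremePoints_subset (WeakDual.isClosed_closedBall 0 1)

theorem abs_apply_le (E : Type u) [NormedAddCommGroup E] [NormedSpace ℝ E]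
    (k : extClosure E) (x : E) : ‖(k : WeakDual ℝ E) x‖ ≤ ‖x‖ := by
  have h : ‖WeakDual.toStrongDual (k : WeakDual ℝ E)‖ ≤ 1 := by
    simpa [dualBall] using extClosure_subset E k.2
  exact (WeakDual.toStrongDual (k : WeakDual ℝ E)).le_of_opNorm_le h x |>.trans_eq (one_mul _)

/-- The canonical map `E → ℓ_∞(K)`, `x ↦ (x* ↦ x*(x))`, where `K` is the weak* closure of the
extreme points of `B_{E*}`. Through it `E` is regarded as a subspace of `ℓ_∞(K)`. -/
def evalMap (E : Type u) [NormedAddCommGroup E] [NormedSpace ℝ E] :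
    E →ₗ[ℝ] EllInfty (extClosure E) where
  toFun x := ⟨fun k => (k : WeakDual ℝ E) x, memℓp_infty ⟨‖x‖, by
    rintro _ ⟨k, rfl⟩
    exact abs_apply_le E k x⟩⟩
  map_add' x y := by
    ext k
    exact map_add (k : WeakDual ℝ E) x y
  map_smul' c x := by
    ext k
    exact map_smul (k : WeakDual ℝ E) c x

/-- A bounded linear map is an isomorphic embedding if it is bounded below, i.e. if it is an
isomorphism onto its range. -/
def IsIsomorphicEmbedding {E : Type u} {F : Type v} [NormedAddCommGroup E] [NormedSpace ℝ E]
    [NormedAddCommGroup F] [NormedSpace ℝ F] (S : E →L[ℝ] F) : Prop :=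
  ∃ c : ℝ, 0 < c ∧ ∀ y : E, c * ‖y‖ ≤ ‖S y‖

/-! ### Renormings -/

/-- A norm on the vector space `Y` that is equivalent to the given one. -/
structure EquivalentNorm (Y : Type u) [NormedAddCommGroup Y] [NormedSpace ℝ Y] where
  /-- the new norm, a function on `Y` -/
  toSeminorm : Seminorm ℝ Y
  lower : ∃ c : ℝ, 0 < c ∧ ∀ y : Y, c * ‖y‖ ≤ toSeminorm y
  upper : ∃ C : ℝ, 0 < C ∧ ∀ y : Y, toSeminorm y ≤ C * ‖y‖

variable {Y : Type u} [NormedAddCommGroup Y] [NormedSpace ℝ Y]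

/-- The vector space `Y` with the norm `N` in place of the original norm. -/
def Renormed (_N : EquivalentNorm Y) : Type u := Y

instance (N : EquivalentNorm Y) : AddCommGroup (Renormed N) := inferInstanceAs (AddCommGroup Y)

instance (N : EquivalentNorm Y) : Module ℝ (Renormed N) := inferInstanceAs (Module ℝ Y)

/-- The identity map of `Y`, from the original space to the renormed one. -/
def toRenormed (N : EquivalentNorm Y) : Y ≃ₗ[ℝ] Renormed N := LinearEquiv.refl ℝ Y

instance (N : EquivalentNorm Y) : Norm (Renormed N) :=
  ⟨fun z => N.toSeminorm ((toRenormed N).symm z)⟩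

theorem norm_toRenormed (N : EquivalentNorm Y) (y : Y) :
    ‖toRenormed N y‖ = N.toSeminorm y := rfl

theorem renormed_core (N : EquivalentNorm Y) : NormedSpace.Core ℝ (Renormed N) where
  norm_nonneg z := apply_nonneg N.toSeminorm ((toRenormed N).symm z)
  norm_smul c z := by
    change N.toSeminorm ((toRenormed N).symm (c • z)) = ‖c‖ * N.toSeminorm ((toRenormed N).symm z)
    rw [map_smul, map_smul_eq_mul]
  norm_triangle z w := by
    change N.toSeminorm ((toRenormed N).symm (z + w)) ≤ _
    rw [map_add]
    exact map_add_le_add N.toSeminorm _ _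
  norm_eq_zero_iff z := by
    obtain ⟨c, hc, h⟩ := N.lower
    constructor
    · intro hz
      have hz' : N.toSeminorm ((toRenormed N).symm z) = 0 := hz
      have h1 := h ((toRenormed N).symm z)
      rw [hz'] at h1
      have h2 : ‖(toRenormed N).symm z‖ ≤ 0 := by
        by_contra hlt
        have := mul_pos hc (not_le.1 hlt)
        linarith
      simpa using norm_le_zero_iff.1 h2
    · rintro rfl
      change N.toSeminorm ((toRenormed N).symm 0) = 0
      rw [map_zero, map_zero]

instance (N : EquivalentNorm Y) : NormedAddCommGroup (Renormed N) :=
  NormedAddCommGroup.ofCore (renormed_core N)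

instance (N : EquivalentNorm Y) : NormedSpace ℝ (Renormed N) :=
  NormedSpace.ofCore (renormed_core N)

end Daugavet

end

/-! The norm of $m_0(K)$ is a supremum up to meagre sets, and $K$ is compact Hausdorff, hence Baire,
so $\|Qx\|=\|x\|$ on $X$. Each nonempty weak* open $U\subset K$ contains an extreme point, hence
meets $\operatorname{ext} B_{X^*}$ in all extreme points of some slice given by a vector $z$
(Choquet). The Daugavet equation for $\varphi\otimes z$ then gives $x\in B_X$ with
$\varphi(x)\approx\|\varphi\|$ that is almost $1$ at a point of $U$
(`IsDaugavetSpace.exists_apply_gt`). If $|f|$ is large on a nonmeagre set, that set is everywhere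
nonmeagre in some open $U$, so $x+\varphi(x)f$ is large on a nonmeagre set: $(X,m_0(K))$ is a
Daugavet pair.

To embed $Y$, extend every $t\in K$ to $h_t\in B_{Y^*}$. As $K$ has no isolated points, $\{z>0\}$
contains disjoint nonempty open sets $U_n$; on $U_n$ add $8\varphi_n$, where the $\varphi_n\in
X^\perp$ norm $Y/X$ up to a factor $2$. The $U_n$ detect the distance to $X$, and the rest of $K$,
by symmetry, still norms $X$. For (b), pull the norm of $m_0(K)$ back along this embedding. -/

section Slices

/-! ### Slices of compact convex sets. -/

open Set Topology

variable {V : Type*} [AddCommGroup V] [Module ℝ V] [TopologicalSpace V]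
  [IsTopologicalAddGroup V] [ContinuousSMul ℝ V]

theorem IsCompact.convexJoin' {C D : Set V} (hC : IsCompact C) (hD : IsCompact D) :
    IsCompact (convexJoin ℝ C D) := by
  have h : convexJoin ℝ C D =
      (fun p : V × V × ℝ => AffineMap.lineMap p.1 p.2.1 p.2.2) '' (C ×ˢ D ×ˢ Icc (0 : ℝ) 1) := by
    ext z
    simp only [mem_convexJoin, segment_eq_image_lineMap, mem_image, mem_prod, Prod.exists]
    constructor
    · rintro ⟨a, ha, b, hb, θ, hθ, rfl⟩
      exact ⟨a, b, θ, ⟨ha, hb, hθ⟩, rfl⟩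
    · rintro ⟨a, b, θ, ⟨ha, hb, hθ⟩, rfl⟩
      exact ⟨a, ha, b, hb, θ, hθ, rfl⟩
  rw [h]
  refine (hC.prod (hD.prod isCompact_Icc)).image ?_
  simp only [AffineMap.lineMap_apply_module]
  fun_prop

/-- The convex join works: an extreme point of `B` on a segment between points of `B` is one of its
endpoints. -/
theorem exists_compact_convex_union {B C D : Set V} {e : V} (hB : Convex ℝ B)
    (he : e ∈ B.extremePoints ℝ) (hC : IsCompact C) (hCc : Convex ℝ C) (hCB : C ⊆ B) (heC : e ∉ C)
    (hD : IsCompact D) (hDc : Convex ℝ D) (hDB : D ⊆ B) (heD : e ∉ D) :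
    ∃ F, IsCompact F ∧ Convex ℝ F ∧ F ⊆ B ∧ e ∉ F ∧ C ∪ D ⊆ F := by
  rcases C.eq_empty_or_nonempty with rfl | hCn
  · exact ⟨D, hD, hDc, hDB, heD, by simp⟩
  rcases D.eq_empty_or_nonempty with rfl | hDn
  · exact ⟨C, hC, hCc, hCB, heC, by simp⟩
  refine ⟨convexJoin ℝ C D, hC.convexJoin' hD, hCc.convexJoin hDc, ?_, ?_,
    union_subset (subset_convexJoin_left hDn) (subset_convexJoin_right hCn)⟩
  · intro z hz
    obtain ⟨a, ha, b, hb, hab⟩ := mem_convexJoin.1 hz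
    exact hB.segment_subset (hCB ha) (hDB hb) hab
  · intro h
    obtain ⟨a, ha, b, hb, hab⟩ := mem_convexJoin.1 h
    rcases (mem_extremePoints_iff_forall_segment.1 he).2 _ (hCB ha) _ (hDB hb) hab with rfl | rfl
    exacts [heC ha, heD hb]

/-- **Choquet's lemma**: the slices form a base of neighbourhoods at an extreme point of a compact
convex set. -/
theorem exists_slice_subset [T2Space V] [LocallyConvexSpace ℝ V] {B U : Set V} {e : V}
    (hBc : IsCompact B) (hB : Convex ℝ B) (he : e ∈ B.extremePoints ℝ) (hU : IsOpen U)
    (heU : e ∈ U) :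
    ∃ (l : V →L[ℝ] ℝ) (α : ℝ), α < l e ∧ ∀ y ∈ B, α < l y → y ∈ U := by
  -- By compactness, finitely many closed half-spaces missing `e` cover `B \ U`; their traces on `B`
  -- are joined into one compact convex set.
  obtain ⟨F, hF, hFc, -, heF, hsub⟩ : ∃ F, IsCompact F ∧ Convex ℝ F ∧ F ⊆ B ∧ e ∉ F ∧ B \ U ⊆ F := by
    refine (hBc.diff hU).induction_on
      (p := fun s => ∃ F, IsCompact F ∧ Convex ℝ F ∧ F ⊆ B ∧ e ∉ F ∧ s ⊆ F) ?_ ?_ ?_ ?_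
    · exact ⟨∅, isCompact_empty, convex_empty, by simp, by simp, by simp⟩
    · rintro s t hst ⟨F, h1, h2, h3, h4, h5⟩
      exact ⟨F, h1, h2, h3, h4, hst.trans h5⟩
    · rintro s t ⟨F, h1, h2, h3, h4, h5⟩ ⟨F', h1', h2', h3', h4', h5'⟩
      obtain ⟨G, g1, g2, g3, g4, g5⟩ := exists_compact_convex_union hB he h1 h2 h3 h4 h1' h2' h3' h4'
      exact ⟨G, g1, g2, g3, g4, (union_subset_union h5 h5').trans g5⟩
    · rintro a ⟨haB, haU⟩
      have hne : a ≠ e := by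
        rintro rfl
        exact haU heU
      obtain ⟨l, hl⟩ := geometric_hahn_banach_point_point hne
      obtain ⟨c, hac, hce⟩ := exists_between hl
      refine ⟨{y | l y < c} ∩ (B \ U), ?_, B ∩ {y | l y ≤ c}, ?_, ?_, inter_subset_left, ?_, ?_⟩
      · rw [inter_comm]
        exact inter_mem_nhdsWithin _ ((isOpen_lt l.continuous continuous_const).mem_nhds hac)
      · exact hBc.inter_right (isClosed_le l.continuous continuous_const)
      · exact hB.inter (convex_halfSpace_le (l : V →ₗ[ℝ] ℝ).isLinear c)
      · rintro ⟨-, h⟩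
        exact absurd h (not_le.2 hce)
      · rintro y ⟨hy, hyB, -⟩
        exact ⟨hyB, (show l y < c from hy).le⟩
  obtain ⟨l, u, hlu, hue⟩ := geometric_hahn_banach_closed_point hFc hF.isClosed heF
  refine ⟨l, u, hue, fun y hy hyl => ?_⟩
  by_contra hyU
  exact absurd (hlu y (hsub ⟨hy, hyU⟩)) (not_lt.2 hyl.le)

end Slices

namespace Daugavet

/-! ### Rank-one operators, the dual ball, and the Daugavet property on weak* open sets. -/

open Set Topology

variable {E : Type*} [NormedAddCommGroup E] [NormedSpace ℝ E]

theorem rank_smulRight {F : Type*} [NormedAddCommGroup F] [NormedSpace ℝ F] {φ : E →L[ℝ] ℝ}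
    (hφ : φ ≠ 0) {z : F} (hz : z ≠ 0) :
    ((φ.smulRight z : E →L[ℝ] F) : E →ₗ[ℝ] F).rank = 1 := by
  obtain ⟨x, hx⟩ := DFunLike.ne_iff.1 hφ
  refine (rank_submodule_eq_one_iff _).2 ⟨z, ⟨(φ x)⁻¹ • x, ?_⟩, hz, ?_⟩
  · change φ ((φ x)⁻¹ • x) • z = z
    rw [map_smul, smul_eq_mul, inv_mul_cancel₀ hx, one_smul]
  · rintro _ ⟨y, rfl⟩
    exact Submodule.mem_span_singleton.2 ⟨φ y, rfl⟩

theorem exists_eq_smulRight_of_rank_eq_one {F : Type*} [NormedAddCommGroup F] [NormedSpace ℝ F]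
    {T : E →L[ℝ] F} (hT : (T : E →ₗ[ℝ] F).rank = 1) :
    ∃ (φ : E →L[ℝ] ℝ) (z : F), φ ≠ 0 ∧ z ≠ 0 ∧ T = φ.smulRight z := by
  obtain ⟨z, ⟨x, hx⟩, hz, hsub⟩ := (rank_submodule_eq_one_iff _).1 hT
  obtain ⟨g, hg⟩ := SeparatingDual.exists_eq_one (R := ℝ) hz
  have h : T = (g ∘L T).smulRight z := by
    ext y
    obtain ⟨c, hc⟩ := Submodule.mem_span_singleton.1 (hsub ⟨y, rfl⟩)
    have hc : c • z = T y := hc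
    simp [← hc, hg]
  refine ⟨g ∘L T, z, fun h0 => hz ?_, hz, h⟩
  rw [← hx, h, h0]
  simp

theorem mem_dualBall_iff {k : WeakDual ℝ E} : k ∈ dualBall E ↔ ∀ x, k x ≤ ‖x‖ := by
  simp only [dualBall, mem_preimage, mem_closedBall_zero_iff]
  constructor
  · intro h x
    exact (le_abs_self _).trans (((WeakDual.toStrongDual k).le_of_opNorm_le h x).trans_eq (one_mul _))
  · intro h
    refine ContinuousLinearMap.opNorm_le_bound _ zero_le_one fun x => ?_
    rw [one_mul, Real.norm_eq_abs, abs_le]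
    have := h (-x)
    rw [map_neg, norm_neg] at this
    exact ⟨neg_le.1 this, h x⟩

theorem isCompact_dualBall : IsCompact (dualBall E) := WeakDual.isCompact_closedBall 0 1

theorem convex_dualBall : Convex ℝ (dualBall E) := by
  intro k hk l hl a b ha hb hab
  rw [mem_dualBall_iff] at *
  intro x
  change a * k x + b * l x ≤ ‖x‖
  calc a * k x + b * l x ≤ a * ‖x‖ + b * ‖x‖ := by gcongr; exacts [hk x, hl x]
    _ = ‖x‖ := by rw [← add_mul, hab, one_mul]

theorem neg_mem_extremePoints {k : WeakDual ℝ E} (hk : k ∈ (dualBall E).extremePoints ℝ) :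
    -k ∈ (dualBall E).extremePoints ℝ := by
  have hneg : ∀ {l : WeakDual ℝ E}, l ∈ dualBall E → -l ∈ dualBall E := by
    intro l hl
    rw [mem_dualBall_iff] at *
    intro x
    have := hl (-x)
    rw [map_neg, norm_neg] at this
    exact this
  refine ⟨hneg hk.1, fun y hy z hz hyz => ?_⟩
  have h : k ∈ openSegment ℝ (-y) (-z) := by
    obtain ⟨a, b, ha, hb, hab, h⟩ := hyz
    refine ⟨a, b, ha, hb, hab, ?_⟩
    rw [← neg_neg k, ← h]
    simp only [smul_neg, neg_add]
  rw [← hk.2 (hneg hy) (hneg hz) h, neg_neg]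

theorem neg_mem_extClosure {k : WeakDual ℝ E} (hk : k ∈ extClosure E) : -k ∈ extClosure E :=
  map_mem_closure continuous_neg hk fun _ => neg_mem_extremePoints

instance : LocallyConvexSpace ℝ (WeakDual ℝ E) :=
  WeakBilin.locallyConvexSpace (B := topDualPairing ℝ E)

/-- The functionals norming `x` form a nonempty weak* compact face, which has an extreme point by
Krein–Milman. -/
theorem exists_extremePoint_apply_eq_norm (x : E) :
    ∃ k ∈ (dualBall E).extremePoints ℝ, k x = ‖x‖ := by
  have hexp : IsExposed ℝ (dualBall E) {k ∈ dualBall E | ∀ l ∈ dualBall E, l x ≤ k x} := fun _ =>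
    ⟨⟨⟨⟨fun k => k x, fun _ _ => rfl⟩, fun _ _ => rfl⟩, WeakDual.eval_continuous x⟩, rfl⟩
  obtain ⟨g, hg, hgx⟩ := exists_dual_vector'' ℝ x
  have hgB : StrongDual.toWeakDual g ∈ dualBall E := by
    simpa [dualBall] using hg
  have hne : {k ∈ dualBall E | ∀ l ∈ dualBall E, l x ≤ k x}.Nonempty := by
    refine ⟨StrongDual.toWeakDual g, hgB, fun l hl => ?_⟩
    exact (mem_dualBall_iff.1 hl x).trans_eq hgx.symm
  obtain ⟨k, hk⟩ := (hexp.isCompact isCompact_dualBall).extremePoints_nonempty hne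
  refine ⟨k, hexp.isExtreme.extremePoints_subset_extremePoints hk, ?_⟩
  refine le_antisymm (mem_dualBall_iff.1 hk.1.1 x) ?_
  exact (hgx.symm.trans_le (hk.1.2 _ hgB))

/-- The slices of the dual ball given by vectors of `E` form a base of weak* neighbourhoods at the
extreme points. -/
theorem exists_weakStar_slice_subset [Nontrivial E] {U : Set (WeakDual ℝ E)} {e : WeakDual ℝ E}
    (he : e ∈ (dualBall E).extremePoints ℝ) (hU : IsOpen U) (heU : e ∈ U) :
    ∃ (x : E) (α : ℝ), x ≠ 0 ∧ 0 ≤ α ∧ α < ‖x‖ ∧ ∀ k ∈ dualBall E, α < k x → k ∈ U := by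
  obtain ⟨l, α, hα, h⟩ := exists_slice_subset isCompact_dualBall convex_dualBall he hU heU
  obtain ⟨x, hx⟩ : ∃ x : E, ∀ k : WeakDual ℝ E, l k = k x := by
    obtain ⟨x, hx⟩ := LinearMap.dualEmbedding_surjective (topDualPairing ℝ E) l
    exact ⟨x, fun k => (DFunLike.congr_fun hx k).symm⟩
  -- If `x = 0`, then `α < 0` and `U` contains the whole dual ball, so any nonzero vector serves.
  by_cases hx0 : x = 0
  · obtain ⟨z, hz⟩ := exists_ne (0 : E)
    refine ⟨z, 0, hz, le_rfl, norm_pos_iff.2 hz, fun k hk _ => h k hk ?_⟩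
    rw [hx, hx0, map_zero] at hα ⊢
    exact hα
  · rw [hx] at hα
    exact ⟨x, max α 0, hx0, le_max_right _ _,
      max_lt (hα.trans_le (mem_dualBall_iff.1 he.1 x)) (norm_pos_iff.2 hx0),
      fun k hk hkx => h k hk (by rw [hx]; exact (le_max_left _ _).trans_lt hkx)⟩

/-- In a space with the Daugavet property, slices of the unit ball and weak* open subsets of
`ext B_{E*}` are in general position. -/
theorem IsDaugavetSpace.exists_apply_gt [Nontrivial E] (hE : IsDaugavetSpace E)
    {U : Set (extClosure E)} (hU : IsOpen U) (hUne : U.Nonempty) {φ : E →L[ℝ] ℝ} (hφ : φ ≠ 0)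
    {ε : ℝ} (hε : 0 < ε) :
    ∃ x : E, ‖x‖ ≤ 1 ∧ ‖φ‖ - ε ≤ φ x ∧ ∃ t ∈ U, 1 - ε < (t : WeakDual ℝ E) x := by
  obtain ⟨U', hU', rfl⟩ := isOpen_induced_iff.1 hU
  obtain ⟨t, ht⟩ := hUne
  obtain ⟨e, heU, he⟩ := mem_closure_iff.1 t.2 U' hU' ht
  obtain ⟨z, α, hz0, hα0, hα, hz⟩ := exists_weakStar_slice_subset he hU' heU
  have hzn : 0 < ‖z‖ := norm_pos_iff.2 hz0
  have hφn : 0 < ‖φ‖ := norm_pos_iff.2 hφ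
  -- The three bounds on `η` yield, in order, `j y > 1 - ε`, `φ y ≥ ‖φ‖ - ε` and `j z > α`.
  obtain ⟨η, hη, hη1, hη2, hη3⟩ : ∃ η : ℝ, 0 < η ∧ η ≤ ε ∧ η ≤ ε * ‖z‖ ∧ η ≤ (‖z‖ - α) * ‖φ‖ :=
    ⟨min ε (min (ε * ‖z‖) ((‖z‖ - α) * ‖φ‖)),
      lt_min hε (lt_min (by positivity) (mul_pos (by linarith) hφn)),
      min_le_left _ _, (min_le_right _ _).trans (min_le_left _ _),
      (min_le_right _ _).trans (min_le_right _ _)⟩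
  have hrank : ((φ.smulRight z : E →L[ℝ] E) : E →ₗ[ℝ] E).rank = 1 := rank_smulRight hφ hz0
  have heq := hE _ hrank
  rw [ContinuousLinearMap.norm_smulRight_apply] at heq
  obtain ⟨x, hx, hlt⟩ : ∃ x : E, ‖x‖ ≤ 1 ∧ 1 + ‖φ‖ * ‖z‖ - η < ‖x + φ x • z‖ := by
    have h1 : 1 + ‖φ‖ * ‖z‖ - η < ‖ContinuousLinearMap.id ℝ E + φ.smulRight z‖ := by linarith
    obtain ⟨x, hx, h2⟩ := ContinuousLinearMap.exists_lt_apply_of_lt_opNorm _ h1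
    exact ⟨x, hx.le, h2⟩
  obtain ⟨k, hk, hkx⟩ := exists_extremePoint_apply_eq_norm (x + φ x • z)
  rw [← hkx, map_add, map_smul, smul_eq_mul] at hlt
  have key : ∀ (y : E) (j : WeakDual ℝ E), ‖y‖ ≤ 1 → j ∈ (dualBall E).extremePoints ℝ → 0 ≤ φ y →
      1 + ‖φ‖ * ‖z‖ - η < j y + φ y * j z →
      ∃ x : E, ‖x‖ ≤ 1 ∧ ‖φ‖ - ε ≤ φ x ∧ ∃ t ∈ ((↑) : extClosure E → WeakDual ℝ E) ⁻¹' U',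
        1 - ε < (t : WeakDual ℝ E) x := by
    intro y j hy hj hφy hlt
    have hjz := mem_dualBall_iff.1 hj.1 z
    have hjy := (mem_dualBall_iff.1 hj.1 y).trans hy
    have hφy' : φ y ≤ ‖φ‖ := (le_abs_self _).trans (φ.unit_le_opNorm y hy)
    have h1 : φ y * j z ≤ φ y * ‖z‖ := mul_le_mul_of_nonneg_left hjz hφy
    have h2 : φ y * ‖z‖ ≤ ‖φ‖ * ‖z‖ := mul_le_mul_of_nonneg_right hφy' hzn.le
    refine ⟨y, hy, ?_, ⟨j, subset_closure hj⟩, hz j hj.1 ?_, ?_⟩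
    · have : (‖φ‖ - ε) * ‖z‖ ≤ φ y * ‖z‖ := by nlinarith
      exact le_of_mul_le_mul_right this hzn
    · by_contra hcon
      have hcon := not_lt.1 hcon
      have h3 : φ y * j z ≤ φ y * α := mul_le_mul_of_nonneg_left hcon hφy
      nlinarith [mul_le_mul_of_nonneg_right hφy' hα0]
    · change 1 - ε < j y
      linarith
  -- Changing the signs of both `x` and `k` preserves the estimate, so `φ x ≥ 0` may be assumed.
  rcases le_or_gt 0 (φ x) with h0 | h0
  · exact key x k hx hk h0 hlt
  · refine key (-x) (-k) (by rwa [norm_neg]) (neg_mem_extremePoints hk)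
      (by rw [map_neg]; linarith) ?_
    have e1 : (-k) (-x) = k x := by
      change -(k (-x)) = k x
      rw [map_neg, neg_neg]
    have e2 : (-k) z = -(k z) := rfl
    rw [e1, e2, map_neg, neg_mul_neg]
    exact hlt

end Daugavet

open Set Topology in
/-- A nonmeagre set in a second countable space is everywhere nonmeagre in some nonempty open
set. -/
theorem exists_isOpen_forall_not_isMeagre_inter {K : Type*} [TopologicalSpace K]
    [SecondCountableTopology K] {A : Set K} (hA : ¬IsMeagre A) :
    ∃ U : Set K, IsOpen U ∧ U.Nonempty ∧
      ∀ V ⊆ U, IsOpen V → V.Nonempty → ¬IsMeagre (A ∩ V) := by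
  by_contra! hcon
  apply hA
  set b := {V ∈ TopologicalSpace.countableBasis K | IsMeagre (A ∩ V)} with hb
  have hbc : b.Countable := (TopologicalSpace.countable_countableBasis K).mono (sep_subset _ _)
  have hopen : IsOpen (⋃₀ b) := isOpen_sUnion fun V hV =>
    (TopologicalSpace.isBasis_countableBasis K).isOpen hV.1
  have h1 : IsMeagre (⋃ V ∈ b, A ∩ V) := isMeagre_biUnion hbc fun V hV => hV.2
  -- If this closed set had interior, `hcon` would give a basic open set inside it that belongs to
  -- `b`.
  have h2 : IsMeagre (⋃₀ b)ᶜ := by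
    apply IsNowhereDense.isMeagre
    rw [hopen.isClosed_compl.isNowhereDense_iff]
    by_contra hne
    obtain ⟨V, hVU, hVo, ⟨t, ht⟩, hVm⟩ := hcon _ isOpen_interior (nonempty_iff_ne_empty.2 hne)
    obtain ⟨W, hW, htW, hWV⟩ :=
      (TopologicalSpace.isBasis_countableBasis K).exists_subset_of_mem_open ht hVo
    exact interior_subset (hVU ht) ⟨W, ⟨hW, hVm.mono (inter_subset_inter_right _ hWV)⟩, htW⟩
  refine (h1.union h2).mono fun t ht => ?_
  by_cases h : t ∈ ⋃₀ b
  · obtain ⟨V, hV, htV⟩ := h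
    exact Or.inl (mem_biUnion hV ⟨ht, htV⟩)
  · exact Or.inr h

namespace Daugavet

open Set Topology

/-! ### The norm of $m_0(K)$ as a supremum modulo meagre sets. -/

section MZero

variable {K : Type*} [TopologicalSpace K]

theorem norm_quotientMap_le (f : EllInfty K) : ‖quotientMap K f‖ ≤ ‖f‖ :=
  Submodule.Quotient.norm_mk_le _ f

theorem le_norm_quotientMap {f : EllInfty K} {r : ℝ} (h : ¬IsMeagre {t | r < |f t|}) :
    r ≤ ‖quotientMap K f‖ := by
  by_contra! hlt
  obtain ⟨g, hg, hgn⟩ := Submodule.Quotient.norm_mk_lt (quotientMap K f) (sub_pos.2 hlt)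
  rw [add_sub_cancel] at hgn
  have hfg : IsMeagre {t | (f - g) t ≠ 0} := (Submodule.Quotient.eq (mSpace K)).1 hg.symm
  refine h (hfg.mono fun t ht => ?_)
  rw [mem_ofPred_eq]
  intro h0
  have ht : r < |f t| := ht
  have h1 : f t = g t := sub_eq_zero.1 h0
  have h2 : |g t| ≤ ‖g‖ := lp.norm_apply_le_norm (by simp) g t
  rw [h1] at ht
  linarith

theorem not_isMeagre_of_lt_norm_quotientMap {f : EllInfty K} {r : ℝ} (hr : 0 ≤ r)
    (h : r < ‖quotientMap K f‖) : ¬IsMeagre {t | r < |f t|} := by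
  classical
  intro hm
  -- Cutting `f` off on a meagre set does not change its class.
  let g : EllInfty K := ⟨fun t => if r < |f t| then 0 else f t, memℓp_infty ⟨r, by
    rintro _ ⟨t, rfl⟩
    dsimp only
    split_ifs with ht
    · simpa using hr
    · exact not_lt.1 ht⟩⟩
  have hg : ‖g‖ ≤ r := by
    refine lp.norm_le_of_forall_le hr fun t => ?_
    change ‖(if r < |f t| then 0 else f t : ℝ)‖ ≤ r
    split_ifs with ht
    · simpa using hr
    · exact not_lt.1 ht
  have hfg : quotientMap K f = quotientMap K g := by
    refine (Submodule.Quotient.eq _).2 (hm.mono fun t ht => ?_)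
    by_contra hlt
    exact ht (sub_eq_zero.2 (if_neg hlt).symm)
  rw [hfg] at h
  exact absurd h (not_lt.2 ((norm_quotientMap_le g).trans hg))

/-- A bounded family of functionals induces a bounded operator into `m₀(K)`. -/
theorem exists_operator {Y : Type*} [NormedAddCommGroup Y] [NormedSpace ℝ Y]
    (g : K → Y →L[ℝ] ℝ) (C : ℝ) (hg : ∀ t, ‖g t‖ ≤ C) :
    ∃ T : Y →ₗ[ℝ] EllInfty K, (∀ y t, T y t = g t y) ∧ ∀ y, ‖quotientMap K (T y)‖ ≤ max C 0 * ‖y‖ := by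
  have hb : ∀ y t, ‖g t y‖ ≤ max C 0 * ‖y‖ := fun y t =>
    (g t).le_of_opNorm_le ((hg t).trans (le_max_left _ _)) y
  let T : Y →ₗ[ℝ] EllInfty K :=
    { toFun := fun y => ⟨fun t => g t y, memℓp_infty ⟨max C 0 * ‖y‖, by
        rintro _ ⟨t, rfl⟩
        exact hb y t⟩⟩
      map_add' := fun y z => by
        ext t
        exact map_add (g t) y z
      map_smul' := fun c y => by
        ext t
        exact map_smul (g t) c y }
  exact ⟨T, fun _ _ => rfl, fun y => (norm_quotientMap_le _).trans
    (lp.norm_le_of_forall_le (by positivity) (hb y))⟩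

end MZero

/-! ### The topology of $K$: metrizability, symmetry, absence of isolated points. -/

section ExtClosure

variable {E : Type*} [NormedAddCommGroup E] [NormedSpace ℝ E]

instance : CompactSpace (extClosure E) :=
  isCompact_iff_compactSpace.1
    (isCompact_dualBall.of_isClosed_subset isClosed_closure (extClosure_subset E))

instance [TopologicalSpace.SeparableSpace E] : SecondCountableTopology (extClosure E) := by
  have := WeakDual.metrizable_of_isCompact ℝ E (extClosure E)
    (isCompact_iff_compactSpace.2 inferInstance)
  let _ := TopologicalSpace.metrizableSpaceMetric (extClosure E)
  infer_instance

theorem continuous_eval (x : E) : Continuous fun t : extClosure E => (t : WeakDual ℝ E) x :=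
  (WeakDual.eval_continuous x).comp continuous_subtype_val

theorem exists_extClosure_apply_eq_norm (x : E) :
    ∃ t : extClosure E, (t : WeakDual ℝ E) x = ‖x‖ := by
  obtain ⟨k, hk, hkx⟩ := exists_extremePoint_apply_eq_norm x
  exact ⟨⟨k, subset_closure hk⟩, hkx⟩

/-- One of the two halves of the extreme points is enough to norm a vector. -/
theorem not_isMeagre_lt_abs_diff (x z : E) {r : ℝ} (hr : r < ‖x‖) :
    ¬IsMeagre ({t : extClosure E | r < |(t : WeakDual ℝ E) x|} \
      {t | 0 < (t : WeakDual ℝ E) z}) := by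
  set V := {t : extClosure E | r < |(t : WeakDual ℝ E) x|}
  set U := {t : extClosure E | 0 < (t : WeakDual ℝ E) z}
  have hV : IsOpen V := isOpen_lt continuous_const (continuous_eval x).abs
  have hne : (V \ closure U).Nonempty := by
    obtain ⟨t, ht⟩ := exists_extClosure_apply_eq_norm x
    have htV : t ∈ V := by
      change r < |(t : WeakDual ℝ E) x|
      rwa [ht, abs_norm]
    by_cases htU : t ∈ closure U
    · obtain ⟨s, hsV, hsU⟩ := mem_closure_iff.1 htU V hV htV
      -- `V` is symmetric, and `-s` lies in the open set `{z < 0}`, which misses `U`.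
      let s' : extClosure E := ⟨-(s : WeakDual ℝ E), neg_mem_extClosure s.2⟩
      have hs' : ∀ y, (s' : WeakDual ℝ E) y = -((s : WeakDual ℝ E) y) := fun _ => rfl
      refine ⟨s', ?_, fun hmem => ?_⟩
      · change r < |(s' : WeakDual ℝ E) x|
        rw [hs', abs_neg]
        exact hsV
      · obtain ⟨u, hu, huU⟩ := mem_closure_iff.1 hmem {t | (t : WeakDual ℝ E) z < 0}
          (isOpen_lt (continuous_eval z) continuous_const)
          (by
            change (s' : WeakDual ℝ E) z < 0
            rw [hs']
            exact neg_lt_zero.2 hsU)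
        exact lt_asymm (show (u : WeakDual ℝ E) z < 0 from hu) huU
    · exact ⟨t, htV, htU⟩
  intro hm
  exact not_isMeagre_of_isOpen (hV.sdiff isClosed_closure) hne
    (hm.mono (sdiff_subset_sdiff_right subset_closure))

/-- At an isolated `t`, applying `exists_apply_gt` to `{t}` and `φ = -t` would make both `t x` and
`-t x` large; for `t = 0`, `t x > 1/2` is already absurd. -/
theorem IsDaugavetSpace.neBot_nhdsNE [Nontrivial E] (hE : IsDaugavetSpace E) (t : extClosure E) :
    (𝓝[≠] t).NeBot := by
  by_contra h
  have ht : IsOpen {t} := isOpen_singleton_iff_punctured_nhds t |>.2 (Filter.not_neBot.1 h)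
  by_cases h0 : WeakDual.toStrongDual (t : WeakDual ℝ E) = 0
  · obtain ⟨z, hz⟩ := exists_ne (0 : E)
    obtain ⟨φ, hφ⟩ := SeparatingDual.exists_eq_one (R := ℝ) hz
    obtain ⟨x, -, -, s, rfl, hs⟩ := hE.exists_apply_gt ht (singleton_nonempty t) (φ := φ)
      (by rintro rfl; simp at hφ) one_half_pos
    have : (s : WeakDual ℝ E) x = 0 := DFunLike.congr_fun h0 x
    linarith
  · obtain ⟨x, -, hx, s, rfl, hs⟩ := hE.exists_apply_gt ht (singleton_nonempty t)
      (neg_ne_zero.2 h0) one_half_pos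
    have h1 : (-WeakDual.toStrongDual (s : WeakDual ℝ E)) x = -((s : WeakDual ℝ E) x) := rfl
    rw [h1] at hx
    linarith [norm_nonneg (-WeakDual.toStrongDual (s : WeakDual ℝ E))]

theorem IsDaugavetSpace.exists_disjoint_isOpen [Nontrivial E] (hE : IsDaugavetSpace E)
    {U₀ : Set (extClosure E)} (hU₀ : IsOpen U₀) (hne : U₀.Nonempty) :
    ∃ U : ℕ → Set (extClosure E), (∀ n, IsOpen (U n)) ∧ (∀ n, (U n).Nonempty) ∧
      (∀ n, U n ⊆ U₀) ∧ ∀ t m n, t ∈ U m → t ∈ U n → m = n := by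
  obtain ⟨t, ht⟩ := hne
  have := hE.neBot_nhdsNE t
  have : Infinite U₀ := (infinite_of_mem_nhds t (hU₀.mem_nhds ht)).to_subtype
  obtain ⟨U, hUi, hUo, hd⟩ := exists_seq_infinite_isOpen_pairwise_disjoint U₀
  refine ⟨fun n => (↑) '' U n, fun n => hU₀.isOpenMap_subtype_val _ (hUo n),
    fun n => (hUi n).nonempty.image _, fun n => Subtype.coe_image_subset _ _, ?_⟩
  rintro _ m n ⟨s, hs, rfl⟩ ⟨s', hs', h⟩
  obtain rfl := Subtype.val_injective h
  by_contra hmn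
  exact disjoint_left.1 (hd hmn) hs hs'

end ExtClosure

/-- The annihilator of a closed subspace of a separable space contains a sequence that norms the
quotient up to a factor `2`. -/
theorem exists_seq_annihilator {Y : Type*} [NormedAddCommGroup Y] [NormedSpace ℝ Y]
    [TopologicalSpace.SeparableSpace Y] (X : Submodule ℝ Y) [IsClosed (X : Set Y)] :
    ∃ φ : ℕ → Y →L[ℝ] ℝ, (∀ n, ‖φ n‖ ≤ 1) ∧ (∀ n, ∀ x ∈ X, φ n x = 0) ∧
      ∀ y, ∃ n, ‖X.mkQ y‖ / 2 ≤ |φ n y| := by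
  have hnorm : ∀ y : Y, ‖X.mkQ y‖ ≤ ‖y‖ := Submodule.Quotient.norm_mk_le X
  let π : Y →L[ℝ] Y ⧸ X := X.mkQ.mkContinuous 1 fun y => by rw [one_mul]; exact hnorm y
  have hπ : ‖π‖ ≤ 1 := X.mkQ.mkContinuous_norm_le zero_le_one _
  choose g hg hgy using fun y : Y => exists_dual_vector'' ℝ (π y)
  let d := TopologicalSpace.denseSeq Y
  refine ⟨fun n => (g (d n)) ∘L π, fun n => ?_, fun n x hx => ?_, fun y => ?_⟩
  · exact (ContinuousLinearMap.opNorm_comp_le _ _).trans (mul_le_one₀ (hg _) (norm_nonneg _) hπ)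
  · have : π x = 0 := (Submodule.Quotient.mk_eq_zero X).2 hx
    simp [this]
  · rcases (norm_nonneg (X.mkQ y)).eq_or_lt with h0 | h0
    · exact ⟨0, by rw [← h0]; simp⟩
    · obtain ⟨n, hn⟩ := (TopologicalSpace.denseRange_denseSeq Y).exists_dist_lt y
        (div_pos h0 four_pos)
      refine ⟨n, ?_⟩
      have hn : ‖y - d n‖ < ‖X.mkQ y‖ / 4 := by rwa [dist_eq_norm] at hn
      change _ ≤ |g (d n) (π y)|
      have h1 : g (d n) (π y) = g (d n) (π (y - d n)) + ‖π (d n)‖ := by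
        rw [map_sub, map_sub, hgy]
        simp
      have h2 : ‖π (y - d n)‖ ≤ ‖y - d n‖ := hnorm _
      have h3 : |g (d n) (π (y - d n))| ≤ ‖π (y - d n)‖ :=
        ((g (d n)).le_of_opNorm_le (hg _) _).trans_eq (one_mul _)
      have h4 : ‖X.mkQ y‖ ≤ ‖π (y - d n)‖ + ‖π (d n)‖ := by
        have : X.mkQ y = π (y - d n) + π (d n) := by rw [← map_add, sub_add_cancel]; rfl
        rw [this]
        exact norm_add_le _ _
      have h5 := neg_abs_le (g (d n) (π (y - d n)))
      have h6 := le_abs_self (g (d n) (π y))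
      linarith

end Daugavet

namespace Daugavet

/-! ### The Daugavet pair in $m_0(K)$, the embedding and the renorming. -/

open Set Topology

theorem norm_quotientMap_evalMap {E : Type*} [NormedAddCommGroup E] [NormedSpace ℝ E] (x : E) :
    ‖quotientMap (extClosure E) (evalMap E x)‖ = ‖x‖ := by
  apply le_antisymm
  · exact (norm_quotientMap_le _).trans
      (lp.norm_le_of_forall_le (norm_nonneg x) fun k => abs_apply_le E k x)
  · refine le_of_forall_lt fun r hr => ?_
    obtain ⟨r', hr', hx⟩ := exists_between hr
    refine hr'.trans_le (le_norm_quotientMap fun hm => ?_)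
    exact not_isMeagre_lt_abs_diff x 0 hx (hm.mono sdiff_subset)

/-- If `E` is separable and has the Daugavet property, so does the pair `(E, m₀(K))`. -/
theorem IsDaugavetSpace.exists_norm_quotientMap_add_ge {E : Type*} [NormedAddCommGroup E]
    [NormedSpace ℝ E] [Nontrivial E] [TopologicalSpace.SeparableSpace E] (hE : IsDaugavetSpace E)
    (F : mZero (extClosure E)) (hF : F ≠ 0) {φ : E →L[ℝ] ℝ} (hφ : φ ≠ 0) {ε : ℝ} (hε : 0 < ε) :
    ∃ x : E, ‖x‖ ≤ 1 ∧
      1 + ‖φ‖ * ‖F‖ - ε ≤ ‖quotientMap (extClosure E) (evalMap E x) + φ x • F‖ := by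
  obtain ⟨f, rfl⟩ := Submodule.mkQ_surjective _ F
  set W := ‖quotientMap (extClosure E) f‖
  have hWpos : 0 < W := norm_pos_iff.2 hF
  have hφn : 0 < ‖φ‖ := norm_pos_iff.2 hφ
  -- Chosen so that `(1 - δ) + (‖φ‖ - δ) * (W - δ)` exceeds `1 + ‖φ‖ * W - ε`.
  obtain ⟨δ, hδ, hδ1, hδ2, hδ3⟩ : ∃ δ : ℝ, 0 < δ ∧ δ ≤ ‖φ‖ ∧ δ ≤ W ∧ δ * (1 + ‖φ‖ + W) ≤ ε := by
    refine ⟨min (ε / (1 + ‖φ‖ + W)) (min ‖φ‖ W), lt_min (by positivity) (lt_min hφn hWpos),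
      (min_le_right _ _).trans (min_le_left _ _), (min_le_right _ _).trans (min_le_right _ _), ?_⟩
    rw [← le_div_iff₀ (by positivity)]
    exact min_le_left _ _
  have hA := not_isMeagre_of_lt_norm_quotientMap (f := f) (sub_nonneg.2 hδ2) (sub_lt_self W hδ)
  obtain ⟨s, hs, hsA⟩ : ∃ s : ℝ, |s| = 1 ∧ ¬IsMeagre {t | W - δ < s * f t} := by
    by_contra! hcon
    refine hA (((hcon 1 (by simp)).union (hcon (-1) (by simp))).mono fun t ht => ?_)
    rcases lt_abs.1 (show W - δ < |f t| from ht) with h | h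
    · left
      change W - δ < 1 * f t
      linarith
    · right
      change W - δ < -1 * f t
      linarith
  have hss : s * s = 1 := by rw [← abs_mul_abs_self, hs, one_mul]
  have hs0 : s ≠ 0 := by
    rintro rfl
    simp at hs
  obtain ⟨U, hU, hUne, hUA⟩ := exists_isOpen_forall_not_isMeagre_inter hsA
  -- Using `s • φ` matches the sign of `φ x` to that of `f` on the nonmeagre set.
  obtain ⟨x, hx, hφx, t, htU, htx⟩ := hE.exists_apply_gt hU hUne (smul_ne_zero hs0 hφ) hδ
  have hsφ : ‖s • φ‖ = ‖φ‖ := by rw [norm_smul, Real.norm_eq_abs, hs, one_mul]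
  have hφx : ‖φ‖ - δ ≤ s * φ x := by rwa [hsφ] at hφx
  refine ⟨x, hx, ?_⟩
  rw [← map_smul, ← map_add]
  refine le_norm_quotientMap fun hm => ?_
  refine hUA (U ∩ {t | 1 - δ < (t : WeakDual ℝ E) x}) inter_subset_left
    (hU.inter (isOpen_lt continuous_const (continuous_eval x))) ⟨t, htU, htx⟩ (hm.mono ?_)
  rintro k ⟨hkA, -, hkx⟩
  have hkA : W - δ < s * f k := hkA
  have hkx : 1 - δ < (k : WeakDual ℝ E) x := hkx
  have hval : (evalMap E x + φ x • f) k = (k : WeakDual ℝ E) x + φ x * f k := rfl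
  change _ < |(evalMap E x + φ x • f) k|
  rw [hval]
  refine lt_of_lt_of_le ?_ (le_abs_self _)
  have h1 : (‖φ‖ - δ) * (W - δ) ≤ (s * φ x) * (s * f k) :=
    mul_le_mul hφx hkA.le (sub_nonneg.2 hδ2) ((sub_nonneg.2 hδ1).trans hφx)
  have h2 : (s * φ x) * (s * f k) = φ x * f k := by
    rw [mul_mul_mul_comm, hss, one_mul]
  nlinarith [mul_pos hδ hδ]

variable {Y : Type*} [NormedAddCommGroup Y] [NormedSpace ℝ Y] [TopologicalSpace.SeparableSpace Y]

/-- The canonical embedding of a subspace with the Daugavet property into `m₀(K)` extends to an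
isomorphic embedding of the whole space. -/
theorem exists_isIsomorphicEmbedding (X : Submodule ℝ Y) (hXclosed : IsClosed (X : Set Y))
    [Nontrivial X] (hX : IsDaugavetSpace X) :
    ∃ S : Y →L[ℝ] mZero (extClosure X), IsIsomorphicEmbedding S ∧
      ∀ x : X, S (x : Y) = quotientMap (extClosure X) (evalMap X x) := by
  classical
  obtain ⟨φ, hφ1, hφX, hφ⟩ := exists_seq_annihilator X
  obtain ⟨z, hz⟩ := exists_ne (0 : X)
  obtain ⟨U, hUo, hUne, hU₀, hUd⟩ := hX.exists_disjoint_isOpen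
    (U₀ := {t | 0 < (t : WeakDual ℝ X) z}) (isOpen_lt continuous_const (continuous_eval z)) (by
      obtain ⟨t, ht⟩ := exists_extClosure_apply_eq_norm z
      refine ⟨t, ?_⟩
      change 0 < (t : WeakDual ℝ X) z
      rw [ht]
      exact norm_pos_iff.2 hz)
  choose h hhX hhn using fun t : extClosure X =>
    exists_extension_norm_eq X (WeakDual.toStrongDual (t : WeakDual ℝ X))
  have hh1 : ∀ t, ‖h t‖ ≤ 1 := fun t => by
    rw [hhn]
    exact mem_closedBall_zero_iff.1 (extClosure_subset X t.2)
  let g : extClosure X → Y →L[ℝ] ℝ := fun t =>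
    if H : ∃ n, t ∈ U n then h t + (8 : ℝ) • φ H.choose else h t
  have hgU : ∀ t n, t ∈ U n → g t = h t + (8 : ℝ) • φ n := fun t n htn => by
    have H : ∃ n, t ∈ U n := ⟨n, htn⟩
    have : g t = h t + (8 : ℝ) • φ H.choose := dif_pos H
    rw [this, hUd t _ _ H.choose_spec htn]
  have hgc : ∀ t, (∀ n, t ∉ U n) → g t = h t := fun t ht => dif_neg (not_exists.2 ht)
  have hg : ∀ t, ‖g t‖ ≤ 9 := fun t => by
    by_cases H : ∃ n, t ∈ U n
    · obtain ⟨n, hn⟩ := H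
      rw [hgU t n hn]
      refine (norm_add_le _ _).trans ?_
      rw [norm_smul, Real.norm_eq_abs, abs_of_pos (by norm_num : (0 : ℝ) < 8)]
      linarith [hh1 t, hφ1 n]
    · rw [hgc t (not_exists.1 H)]
      linarith [hh1 t]
  have hgX : ∀ t (x : X), g t x = (t : WeakDual ℝ X) x := fun t x => by
    by_cases H : ∃ n, t ∈ U n
    · obtain ⟨n, hn⟩ := H
      rw [hgU t n hn]
      change h t x + 8 * φ n x = _
      rw [hφX n x x.2, mul_zero, add_zero, hhX]
      rfl
    · rw [hgc t (not_exists.1 H), hhX]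
      rfl
  obtain ⟨T, hT, hTn⟩ := exists_operator g 9 hg
  let S : Y →L[ℝ] mZero (extClosure X) :=
    (quotientMap (extClosure X) ∘ₗ T).mkContinuous (max 9 0) hTn
  have hSX : ∀ x : X, S (x : Y) = quotientMap (extClosure X) (evalMap X x) := fun x => by
    change quotientMap (extClosure X) (T x) = _
    congr 1
    ext t
    rw [hT, hgX]
    rfl
  -- With `d` the distance from `y` to `X`, one third of `4 * d - ‖y‖` plus two thirds of `‖y‖ - 2 *
  -- d` is `‖y‖ / 3`.
  refine ⟨S, ⟨1 / 3, by norm_num, fun y => ?_⟩, hSX⟩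
  have hSy : ‖S y‖ = ‖quotientMap (extClosure X) (T y)‖ := rfl
  have hhy : ∀ t w, |h t w| ≤ ‖w‖ := fun t w =>
    ((h t).le_of_opNorm_le (hh1 t) w).trans_eq (one_mul _)
  set d := ‖X.mkQ y‖
  -- On a suitable `U n`, the term `8 * φ n y` has modulus at least `4 * d`, and `h t y` removes at
  -- most `‖y‖`.
  have hfar : 4 * d - ‖y‖ ≤ ‖S y‖ := by
    refine le_of_forall_pos_le_add fun ε hε => ?_
    rw [← sub_le_iff_le_add, hSy]
    obtain ⟨n, hn⟩ := hφ y
    refine le_norm_quotientMap fun hm => not_isMeagre_of_isOpen (hUo n) (hUne n) (hm.mono ?_)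
    intro t ht
    change _ < |T y t|
    rw [hT, hgU t n ht]
    change _ < |h t y + 8 * φ n y|
    have h1 : |8 * φ n y| ≤ |h t y + 8 * φ n y| + |h t y| := by
      have := abs_sub (h t y + 8 * φ n y) (h t y)
      rwa [add_sub_cancel_left] at this
    rw [abs_mul, abs_of_pos (by norm_num : (0 : ℝ) < 8)] at h1
    linarith [hhy t y]
  -- Write `y = x + w` with `‖w‖` close to `d`. Off `{z > 0}` nothing was added to `h t`, and `x` is
  -- still normed there; `w` costs its norm twice.
  have hnear : ‖y‖ - 2 * d ≤ ‖S y‖ := by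
    refine le_of_forall_pos_le_add fun ε hε => ?_
    rw [← sub_le_iff_le_add, hSy]
    obtain ⟨w, hw, hwn⟩ := Submodule.Quotient.norm_mk_lt (X.mkQ y) (div_pos hε four_pos)
    have hyw : y - w ∈ X := (Submodule.Quotient.eq X).1 hw.symm
    set x : X := ⟨y - w, hyw⟩ with hx
    have hxn : ‖y‖ - ‖w‖ ≤ ‖x‖ := norm_sub_norm_le y w
    refine le_norm_quotientMap fun hm =>
      not_isMeagre_lt_abs_diff x z (r := ‖x‖ - ε / 4) (by linarith) (hm.mono ?_)
    rintro t ⟨htx, htz⟩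
    have htx : ‖x‖ - ε / 4 < |(t : WeakDual ℝ X) x| := htx
    change _ < |T y t|
    rw [hT]
    have h1 : g t y = (t : WeakDual ℝ X) x + h t w := by
      rw [← hgX t x, hgc t fun n hn => htz (hU₀ n hn), ← map_add]
      simp [hx]
    rw [h1]
    have h2 : |(t : WeakDual ℝ X) x| ≤ |(t : WeakDual ℝ X) x + h t w| + |h t w| := by
      have := abs_sub ((t : WeakDual ℝ X) x + h t w) (h t w)
      rwa [add_sub_cancel_right] at this
    linarith [hhy t w]
  linarith

/-- The norm transported from a space into which `Y` is isomorphically embedded. -/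
noncomputable def EquivalentNorm.ofEmbedding {Y M : Type*} [NormedAddCommGroup Y] [NormedSpace ℝ Y]
    [NormedAddCommGroup M] [NormedSpace ℝ M] (S : Y →L[ℝ] M) (hS : IsIsomorphicEmbedding S) :
    EquivalentNorm Y where
  toSeminorm := (normSeminorm ℝ M).comp (S : Y →ₗ[ℝ] M)
  lower := hS
  upper := ⟨‖S‖ + 1, by positivity, fun y => (S.le_opNorm y).trans (by gcongr; linarith)⟩

/-- `S` is isometric for the new norm, so the estimate in $m_0(K)$ with `F = S w` transfers to the
rank-one operator with range spanned by `w`. -/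
theorem isDaugavetPair_renormed (X : Submodule ℝ Y) [Nontrivial X] (hX : IsDaugavetSpace X)
    (S : Y →L[ℝ] mZero (extClosure X)) (hS : IsIsomorphicEmbedding S)
    (hSX : ∀ x : X, S (x : Y) = quotientMap (extClosure X) (evalMap X x)) :
    IsDaugavetPair (X.map (toRenormed (EquivalentNorm.ofEmbedding S hS)).toLinearMap) := by
  set N := EquivalentNorm.ofEmbedding S hS
  set X' := X.map (toRenormed N).toLinearMap
  intro T hT
  obtain ⟨φ', w', hφ', hw', rfl⟩ := exists_eq_smulRight_of_rank_eq_one hT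
  obtain ⟨w, rfl⟩ := (toRenormed N).surjective w'
  have hN : ∀ y, ‖toRenormed N y‖ = ‖S y‖ := fun _ => rfl
  have hnX : ∀ x : X, ‖toRenormed N (x : Y)‖ = ‖x‖ := fun x => by
    rw [hN, hSX, norm_quotientMap_evalMap]
  let j : X →ₗᵢ[ℝ] X' :=
    { toFun := fun x => ⟨toRenormed N (x : Y), Submodule.mem_map_of_mem x.2⟩
      map_add' := fun _ _ => rfl
      map_smul' := fun _ _ => rfl
      norm_map' := hnX }
  have hj : Function.Surjective j := by
    rintro ⟨_, y, hy, rfl⟩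
    exact ⟨⟨y, hy⟩, rfl⟩
  let φ : X →L[ℝ] ℝ := φ' ∘L j.toContinuousLinearMap
  have hφφ' : ‖φ'‖ ≤ ‖φ‖ := by
    refine φ'.opNorm_le_bound φ.opNorm_nonneg fun z => ?_
    obtain ⟨x, rfl⟩ := hj z
    rw [j.norm_map]
    exact φ.le_opNorm x
  have hφ : φ ≠ 0 := by
    refine fun h0 => hφ' (ContinuousLinearMap.ext fun z => ?_)
    obtain ⟨x, rfl⟩ := hj z
    exact DFunLike.congr_fun h0 x
  have hSw : S w ≠ 0 := by
    rw [← norm_pos_iff, ← hN]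
    exact norm_pos_iff.2 hw'
  refine le_antisymm ((norm_add_le _ _).trans (by gcongr; exact X'.norm_subtypeL_le)) ?_
  rw [ContinuousLinearMap.norm_smulRight_apply, hN]
  refine le_of_forall_pos_le_add fun ε hε => ?_
  obtain ⟨x, hx, hle⟩ := hX.exists_norm_quotientMap_add_ge (S w) hSw hφ hε
  have h1 : ‖X'.subtypeL (j x) + φ'.smulRight (toRenormed N w) (j x)‖ =
      ‖quotientMap (extClosure X) (evalMap X x) + φ x • S w‖ := by
    rw [← hSX, ← map_smul, ← map_add, ← hN]
    rfl
  have h2 := (X'.subtypeL + φ'.smulRight (toRenormed N w)).unit_le_opNorm (j x)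
    (by rwa [j.norm_map])
  rw [add_apply, h1] at h2
  have h3 : ‖φ'‖ * ‖S w‖ ≤ ‖φ‖ * ‖S w‖ := by gcongr
  linarith

end Daugavet

theorem theorem2p5 {Y : Type*} [NormedAddCommGroup Y] [NormedSpace ℝ Y] [CompleteSpace Y]
    [TopologicalSpace.SeparableSpace Y]
    (X : Submodule ℝ Y) (hXclosed : IsClosed (X : Set Y))
    (hX : Daugavet.IsDaugavetSpace X) :
    (X ≠ ⊥ →
      ∃ S : Y →L[ℝ] Daugavet.mZero (Daugavet.extClosure X),
        Daugavet.IsIsomorphicEmbedding S ∧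
        ∀ x : X, S (x : Y) =
          Daugavet.quotientMap (Daugavet.extClosure X) (Daugavet.evalMap X x)) ∧
    (∃ N : Daugavet.EquivalentNorm Y,
      (∀ x ∈ X, N.toSeminorm x = ‖x‖) ∧
      Daugavet.IsDaugavetPair (X.map (Daugavet.toRenormed N).toLinearMap)) := by
  have hemb : X ≠ ⊥ → ∃ S : Y →L[ℝ] Daugavet.mZero (Daugavet.extClosure X),
      Daugavet.IsIsomorphicEmbedding S ∧ ∀ x : X, S (x : Y) =
        Daugavet.quotientMap (Daugavet.extClosure X) (Daugavet.evalMap X x) := fun hne => by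
    have : Nontrivial X := Submodule.nontrivial_iff_ne_bot.2 hne
    exact Daugavet.exists_isIsomorphicEmbedding X hXclosed hX
  refine ⟨hemb, ?_⟩
  by_cases hbot : X = ⊥
  -- The zero space admits no rank-one operator, so the original norm will do.
  · subst hbot
    refine ⟨Daugavet.EquivalentNorm.ofEmbedding (ContinuousLinearMap.id ℝ Y)
      ⟨1, one_pos, fun y => (one_mul _).le⟩, fun x _ => rfl, fun T hT => ?_⟩
    obtain ⟨φ, -, hφ, -, -⟩ := Daugavet.exists_eq_smulRight_of_rank_eq_one hT
    refine absurd ?_ hφ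
    ext ⟨x, hx⟩
    obtain rfl : x = 0 := by rwa [Submodule.map_bot, Submodule.mem_bot] at hx
    exact map_zero φ
  · have : Nontrivial X := Submodule.nontrivial_iff_ne_bot.2 hbot
    obtain ⟨S, hS, hSX⟩ := hemb hbot
    refine ⟨Daugavet.EquivalentNorm.ofEmbedding S hS, fun x hx => ?_,
      Daugavet.isDaugavetPair_renormed X hX S hS hSX⟩
    change ‖S x‖ = ‖x‖
    exact (congrArg norm (hSX ⟨x, hx⟩)).trans (Daugavet.norm_quotientMap_evalMap _)
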